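/- Let $X$ and $Y$ be standard Borel spaces and let $G$ be a countable group acting on $X$ and on $Y$ by Borel isomorphisms. Let $E_G^X=\{(x,x')\in X^2 \mid \exists g\in G,\ gx=x'\}$ be the orbit equivalence relation on $X$, and define $E_G^Y$ likewise. A Borel equivalence relation $E$ on a standard Borel space $Z$ (that is, one that is a Borel subset of $Z^2$) is called hyperfinite if there are Borel equivalence relations $E_0\subset E_1\subset E_2\subset\cdots$ on $Z$, each with all classes finite, such that $E=\bigcup_{n} E_n$. Suppose that there exists a $G$-equivariant, surjective Borel map $f\colon X\to Y$ such that $f^{-1}(y)$ is finite for every $y\in Y$. Then $E_G^X$ is hyperfinite if and only if $E_G^Y$ is hyperfinite. -/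

import Mathlib

/-- An equivalence relation on `X` is Borel if it is a Borel subset of `X × X`. -/
def Setoid.IsBorel {X : Type*} [MeasurableSpace X] (E : Setoid X) : Prop :=
  MeasurableSet {p : X × X | E p.1 p.2}

/-- An equivalence relation is finite if each of its classes is finite. -/
def Setoid.HasFiniteClasses {X : Type*} (E : Setoid X) : Prop :=
  ∀ x : X, {y : X | E x y}.Finite

/-- A Borel equivalence relation is hyperfinite if it is the union of an increasing sequence of
finite Borel equivalence relations. -/
def Setoid.IsHyperfinite {X : Type*} [MeasurableSpace X] (E : Setoid X) : Prop :=
  E.IsBorel ∧ ∃ F : ℕ → Setoid X,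
    (∀ n, (F n).IsBorel ∧ (F n).HasFiniteClasses) ∧
    (∀ n x y, F n x y → F (n + 1) x y) ∧
    ∀ x y, E x y ↔ ∃ n, F n x y

/-! Let `F n` be finite Borel relations increasing to an orbit relation. From `Y` to `X`, pull each
`F n` back along `f` and intersect with the orbit relation of `X`; classes stay finite because
fibres are finite. From `X` to `Y`, relate `y` and `y'` at stage `n` when their fibres have the same
`F n`-saturation. If `y = g • y'`, each of the finitely many points over `y'` is eventually `F
n`-related to its `g`-translate, so one `n` serves the whole fibre. Borelness is the hard point:
"for all `x` over `y`" is the complement of a projection, and it is Borel because finite-to-one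
Borel maps send Borel sets to Borel sets. This follows from Lusin–Souslin when fibre sizes are
bounded, and Novikov separation reduces the general case to that one. -/

open MeasureTheory Set PiNat

/-! ### Novikov separation of analytic sets -/

/-- The **Novikov separation theorem** for continuous images of the Baire space. -/
theorem exists_measurable_superset_iInter_range_eq_empty {Z : Type*} [TopologicalSpace Z]
    [T2Space Z] [MeasurableSpace Z] [OpensMeasurableSpace Z] {f : ℕ → (ℕ → ℕ) → Z}
    (hf : ∀ n, Continuous (f n)) (h : ⋂ n, range (f n) = ∅) :
    ∃ B : ℕ → Set Z, (∀ n, MeasurableSet (B n)) ∧ (∀ n, range (f n) ⊆ B n) ∧ ⋂ n, B n = ∅ := by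
  -- A single point of the Baire space codes one argument for each `f n`.
  let F : ℕ → (ℕ → ℕ) → Z := fun n x => f n fun j => x (Nat.pair n j)
  have hF : ∀ n, Continuous (F n) := fun n => (hf n).comp (by fun_prop)
  have hF_range : ∀ n, range (f n) ⊆ F n '' univ := by
    rintro n _ ⟨y, rfl⟩
    exact ⟨fun k => y k.unpair.2, mem_univ _, by simp [F]⟩
  -- If `P univ` fails, `P` fails on a nested sequence of cylinders shrinking to a point, which
  -- continuity contradicts.
  let P : Set (ℕ → ℕ) → Prop := fun S => ∃ B : ℕ → Set Z,
    (∀ n, MeasurableSet (B n)) ∧ (∀ n, F n '' S ⊆ B n) ∧ ⋂ n, B n = ∅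
  suffices hP : P univ by
    obtain ⟨B, hB, hFB, hB'⟩ := hP
    exact ⟨B, hB, fun n => (hF_range n).trans (hFB n), hB'⟩
  by_contra hP
  have step : ∀ k x, ¬ P (cylinder x k) →
      ∃ i, ¬ P (cylinder (Function.update x k i) (k + 1)) := by
    intro k x
    contrapose!
    intro H
    choose B hB hFB hB' using H
    -- Coordinate `k` enters only `F n` with `n = k.unpair.1`, whose image splits into a union over
    -- `i`. Every other `F n` has the same image on each piece, so the intersection still covers it.
    refine ⟨fun n => if n = k.unpair.1 then ⋃ i, B i n else ⋂ i, B i n, fun n => ?_, fun n => ?_, ?_⟩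
    · dsimp only
      split_ifs
      · exact MeasurableSet.iUnion fun i => hB i n
      · exact MeasurableSet.iInter fun i => hB i n
    · dsimp only
      split_ifs with hn
      · rw [← iUnion_cylinder_update x k, image_iUnion]
        exact iUnion_mono fun i => hFB i n
      · refine subset_iInter fun i => ?_
        rintro _ ⟨y, hy, rfl⟩
        refine hFB i n ⟨Function.update y k i, ?_, ?_⟩
        · rw [mem_cylinder_iff] at hy ⊢
          intro j hj
          rcases eq_or_ne j k with rfl | hjk
          · simp
          · simpa [hjk] using hy j (by omega)
        · have : ∀ j, Nat.pair n j ≠ k := by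
            rintro j rfl
            simp at hn
          simp [F, this]
    · refine eq_empty_of_forall_notMem fun z hz => ?_
      rw [mem_iInter] at hz
      obtain ⟨i, hi⟩ : ∃ i, z ∈ B i k.unpair.1 := by simpa using hz k.unpair.1
      have : z ∈ ⋂ n, B i n := by
        refine mem_iInter.2 fun n => ?_
        by_cases hn : n = k.unpair.1
        · exact hn ▸ hi
        · have := hz n
          rw [if_neg hn, mem_iInter] at this
          exact this i
      rw [hB' i] at this
      exact this
  choose! c hc using step
  let p : ℕ → ℕ → ℕ := fun n => Nat.rec (fun _ => 0) (fun k x => Function.update x k (c k x)) n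
  have p_succ : ∀ k, p (k + 1) = Function.update (p k) k (c k (p k)) := fun _ => rfl
  have hp : ∀ k, ¬ P (cylinder (p k) k) := by
    intro k
    induction k with
    | zero => simpa using hP
    | succ k ih => exact p_succ k ▸ hc k _ ih
  let x : ℕ → ℕ := fun k => p (k + 1) k
  have hpx : ∀ k, ∀ j < k, p k j = x j := by
    intro k
    induction k with
    | zero => simp
    | succ k ih =>
      intro j hj
      rcases eq_or_ne j k with rfl | hjk
      · rfl
      · rw [p_succ, Function.update_of_ne hjk]
        exact ih j (by omega)
  have hx : ∀ k, ¬ P (cylinder x k) := fun k => by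
    rw [← mem_cylinder_iff_eq.1 (mem_cylinder_iff.2 (hpx k))]
    exact hp k
  -- Two distinct values have disjoint open neighbourhoods, which separate the images of a small
  -- enough cylinder around `x`.
  obtain ⟨n, hn⟩ : ∃ n, F n x ≠ F 0 x := by
    by_contra! hx
    have : F 0 x ∈ ⋂ n, range (f n) := mem_iInter.2 fun n => hx n ▸ mem_range_self _
    rw [h] at this
    exact this
  have hn0 : n ≠ 0 := by
    rintro rfl
    exact hn rfl
  obtain ⟨U, V, hU, hV, hxU, hxV, hUV⟩ := t2_separation hn
  have hW : F n ⁻¹' U ∩ F 0 ⁻¹' V ∈ nhds x :=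
    ((hU.preimage (hF n)).inter (hV.preimage (hF 0))).mem_nhds ⟨hxU, hxV⟩
  obtain ⟨_, ⟨y, k, rfl⟩, hxy, hk⟩ := (isTopologicalBasis_cylinders fun _ => ℕ).mem_nhds_iff.1 hW
  rw [← mem_cylinder_iff_eq.1 hxy] at hk
  refine hx k ⟨fun m => if m = n then U else if m = 0 then V else univ, fun m => ?_, fun m => ?_, ?_⟩
  · dsimp only
    split_ifs
    exacts [hU.measurableSet, hV.measurableSet, MeasurableSet.univ]
  · dsimp only
    split_ifs with h1 h2
    · subst h1
      exact image_subset_iff.2 fun z hz => (hk hz).1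
    · subst h2
      exact image_subset_iff.2 fun z hz => (hk hz).2
    · exact subset_univ _
  · refine eq_empty_of_forall_notMem fun z hz => ?_
    rw [mem_iInter] at hz
    have hzU : z ∈ U := by simpa using hz n
    have hzV : z ∈ V := by simpa [hn0.symm] using hz 0
    exact hUV.notMem_of_mem_left hzU hzV

/-- The **Novikov separation theorem**: a sequence of analytic sets with empty intersection can be
enlarged to a sequence of Borel sets with empty intersection. -/
theorem MeasureTheory.AnalyticSet.exists_measurable_superset_iInter_eq_empty {Z : Type*}
    [TopologicalSpace Z] [T2Space Z] [MeasurableSpace Z] [OpensMeasurableSpace Z] {A : ℕ → Set Z}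
    (hA : ∀ n, AnalyticSet (A n)) (h : ⋂ n, A n = ∅) :
    ∃ B : ℕ → Set Z, (∀ n, MeasurableSet (B n)) ∧ (∀ n, A n ⊆ B n) ∧ ⋂ n, B n = ∅ := by
  by_cases hne : ∃ n, A n = ∅
  · obtain ⟨n, hn⟩ := hne
    refine ⟨fun m => if m = n then ∅ else univ, fun m => ?_, fun m => ?_, ?_⟩
    · dsimp only
      split_ifs
      exacts [MeasurableSet.empty, MeasurableSet.univ]
    · dsimp only
      split_ifs with hm
      · exact (hm ▸ hn).subset
      · exact subset_univ _
    · exact eq_empty_of_forall_notMem fun z hz => by simpa using mem_iInter.1 hz n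
  · push Not at hne
    have hA' : ∀ n, ∃ f : (ℕ → ℕ) → Z, Continuous f ∧ range f = A n := fun n => by
      have := hA n
      rw [AnalyticSet] at this
      exact this.resolve_left (hne n).ne_empty
    choose f hf hfA using hA'
    obtain ⟨B, hB, hfB, hB'⟩ :=
      exists_measurable_superset_iInter_range_eq_empty hf (by simpa [hfA] using h)
    exact ⟨B, hB, fun n => hfA n ▸ hfB n, hB'⟩

/-! ### Borel images under finite-to-one maps -/

section FiniteToOne

variable {X Y : Type*} [MeasurableSpace X] [StandardBorelSpace X]

/-- The tuples of length `k + 1` in a common fibre of `f` on `A`, listed in increasing order with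
respect to a Borel linear order on `X`. -/
def increasingFiberTuples (f : X → Y) (A : Set X) (k : ℕ) : Set (Fin (k + 1) → X) :=
  {x | (∀ i, x i ∈ A) ∧ (StrictMono fun i => embeddingReal X (x i)) ∧ ∀ i, f (x i) = f (x 0)}

theorem image_increasingFiberTuples (f : X → Y) (A : Set X) (k : ℕ) :
    (fun x => f (x 0)) '' increasingFiberTuples f A k =
      {y | ((k + 1 : ℕ) : ℕ∞) ≤ (A ∩ f ⁻¹' {y}).encard} := by
  ext y
  constructor
  · rintro ⟨x, ⟨hxA, hx, hxf⟩, rfl⟩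
    have hinj : Function.Injective x := fun i j hij => hx.injective (by simp [hij])
    have hsub : range x ⊆ A ∩ f ⁻¹' {f (x 0)} := by
      rintro _ ⟨i, rfl⟩
      exact ⟨hxA i, hxf i⟩
    calc ((k + 1 : ℕ) : ℕ∞) = (range x).encard := by
          rw [← image_univ, hinj.encard_image]; simp
      _ ≤ _ := encard_le_encard hsub
  · intro hy
    obtain ⟨t, ht, htk⟩ := exists_subset_encard_eq hy
    have htfin : t.Finite := finite_of_encard_eq_coe htk
    let e := embeddingReal X
    have he : Function.Injective e := (measurableEmbedding_embeddingReal X).injective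
    let s : Finset ℝ := (htfin.image e).toFinset
    have hs : s.card = k + 1 := by
      have : ((s.card : ℕ) : ℕ∞) = (k + 1 : ℕ) := by
        rw [← encard_coe_eq_coe_finsetCard, Finite.coe_toFinset, he.encard_image, htk]
      exact_mod_cast this
    have hmem : ∀ i, ∃ a ∈ t, e a = s.orderEmbOfFin hs i := fun i => by
      have := s.orderEmbOfFin_mem hs i
      rwa [Finite.mem_toFinset] at this
    choose x hxt hxe using hmem
    have hxy : ∀ i, f (x i) = y := fun i => (ht (hxt i)).2
    refine ⟨x, ⟨fun i => (ht (hxt i)).1, ?_, fun i => (hxy i).trans (hxy 0).symm⟩, hxy 0⟩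
    have : (fun i => e (x i)) = s.orderEmbOfFin hs := funext hxe
    exact this ▸ (s.orderEmbOfFin hs).strictMono

/-- Under the size bound such a tuple exhausts its fibre, and an increasing enumeration is
determined by its range. -/
theorem injOn_increasingFiberTuples {f : X → Y} {A : Set X} {k : ℕ}
    (hk : ∀ y, (A ∩ f ⁻¹' {y}).encard ≤ (k + 1 : ℕ)) :
    InjOn (fun x => f (x 0)) (increasingFiberTuples f A k) := by
  have key : ∀ x ∈ increasingFiberTuples f A k, range x = A ∩ f ⁻¹' {f (x 0)} := by
    rintro x ⟨hxA, hx, hxf⟩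
    have hinj : Function.Injective x := fun i j hij => hx.injective (by simp [hij])
    refine Finite.eq_of_subset_of_encard_le' (finite_of_encard_le_coe (hk _)) ?_ ?_
    · rintro _ ⟨i, rfl⟩
      exact ⟨hxA i, hxf i⟩
    · refine (hk _).trans ?_
      rw [← image_univ, hinj.encard_image]
      simp
  intro x hx x' hx' hxx'
  have hrange : range x = range x' := by
    rw [key x hx, key x' hx']
    exact congrArg (fun y => A ∩ f ⁻¹' {y}) hxx'
  have : (fun i => embeddingReal X (x i)) = fun i => embeddingReal X (x' i) := by
    refine (StrictMono.range_inj hx.2.1 hx'.2.1).1 ?_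
    change range (embeddingReal X ∘ x) = range (embeddingReal X ∘ x')
    rw [range_comp, range_comp, hrange]
  exact funext fun i => (measurableEmbedding_embeddingReal X).injective (congrFun this i)

variable [MeasurableSpace Y] [StandardBorelSpace Y]

theorem measurableSet_increasingFiberTuples {f : X → Y} (hf : Measurable f) {A : Set X}
    (hA : MeasurableSet A) (k : ℕ) : MeasurableSet (increasingFiberTuples f A k) := by
  refine .inter (measurableSet_setOfPred.2 <| .forall fun i => hA.mem.comp (measurable_pi_apply i))
    (.inter (measurableSet_setOfPred.2 <| .forall fun i => .forall fun j => .imp measurable_const ?_)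
      (measurableSet_setOfPred.2 <| .forall fun i => ?_))
  · exact measurableSet_setOfPred.1 <| measurableSet_lt
      ((measurable_embeddingReal X).comp (measurable_pi_apply i))
      ((measurable_embeddingReal X).comp (measurable_pi_apply j))
  · exact measurableSet_setOfPred.1 <| measurableSet_eq_fun
      (hf.comp (measurable_pi_apply i)) (hf.comp (measurable_pi_apply 0))

/-- The image of a Borel set under a Borel map with fibres of bounded size is Borel. -/
theorem MeasurableSet.image_of_encard_fiber_le {f : X → Y} (hf : Measurable f) (n : ℕ) {A : Set X}
    (hA : MeasurableSet A) (hn : ∀ y, (A ∩ f ⁻¹' {y}).encard ≤ n) : MeasurableSet (f '' A) := by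
  induction n generalizing A with
  | zero =>
    have : A = ∅ := eq_empty_of_forall_notMem fun x hx => by
      have h0 : A ∩ f ⁻¹' {f x} = ∅ := by simpa using hn (f x)
      exact h0.subset ⟨hx, rfl⟩
    simp [this]
  | succ n ih =>
    -- The points with fibres of maximal size form an injective Borel image; removing them lowers
    -- the bound to `n`.
    let D : Set Y := {y | ((n + 1 : ℕ) : ℕ∞) ≤ (A ∩ f ⁻¹' {y}).encard}
    have hD : MeasurableSet D := by
      have hT := (measurableSet_increasingFiberTuples hf hA n).image_of_measurable_injOn
        (hf.comp (measurable_pi_apply 0)) (injOn_increasingFiberTuples hn)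
      have hD_eq : _ = D := image_increasingFiberTuples f A n
      rw [← hD_eq]
      exact hT
    have hrest : MeasurableSet (f '' (A \ f ⁻¹' D)) := by
      refine ih (hA.diff (hf hD)) fun y => ?_
      by_cases hy : y ∈ D
      · have : A \ f ⁻¹' D ∩ f ⁻¹' {y} = ∅ := eq_empty_of_forall_notMem fun x hx =>
          hx.1.2 (by have : f x = y := hx.2
                     simpa [this] using hy)
        simp [this]
      · refine (encard_le_encard (inter_subset_inter_left _ sdiff_subset)).trans ?_
        have : (A ∩ f ⁻¹' {y}).encard < (n + 1 : ℕ) := not_le.1 hy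
        rw [Nat.cast_add, Nat.cast_one] at this
        exact Order.le_of_lt_add_one this
    have hDA : D ⊆ f '' A := by
      intro y hy
      have hne : (A ∩ f ⁻¹' {y}).Nonempty := by
        rw [← encard_pos]
        exact lt_of_lt_of_le (by simp) hy
      obtain ⟨x, hx, hxy⟩ := hne
      exact ⟨x, hx, hxy⟩
    have : f '' A = D ∪ f '' (A \ f ⁻¹' D) := by
      refine Subset.antisymm ?_ (union_subset hDA (image_mono sdiff_subset))
      rintro _ ⟨x, hx, rfl⟩
      by_cases hxD : f x ∈ D
      · exact .inl hxD
      · exact .inr ⟨x, ⟨hx, hxD⟩, rfl⟩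
    rw [this]
    exact hD.union hrest

/-- The image of a Borel set under a finite-to-one Borel map is Borel. -/
theorem MeasurableSet.image_of_finite_fiber {f : X → Y} (hf : Measurable f) {A : Set X}
    (hA : MeasurableSet A) (hfin : ∀ y, (f ⁻¹' {y}).Finite) : MeasurableSet (f '' A) := by
  let := upgradeStandardBorel Y
  -- No finite fibre has at least `k + 1` points for every `k`, so these analytic sets have empty
  -- intersection. Off `B k` fibres have fewer than `k + 1` points, and the complements of the `B k`
  -- cover `Y`.
  obtain ⟨B, hB, hDB, hB'⟩ := AnalyticSet.exists_measurable_superset_iInter_eq_empty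
    (A := fun k => {y | ((k + 1 : ℕ) : ℕ∞) ≤ (A ∩ f ⁻¹' {y}).encard})
    (fun k => by
      rw [← image_increasingFiberTuples]
      exact (measurableSet_increasingFiberTuples hf hA k).analyticSet_image
        (hf.comp (measurable_pi_apply 0)))
    (eq_empty_of_forall_notMem fun y hy => by
      obtain ⟨k, hk⟩ := ((hfin y).subset inter_subset_right : (A ∩ f ⁻¹' {y}).Finite).encard_lt_top
        |> fun h => ENat.ne_top_iff_exists.1 h.ne
      have := mem_iInter.1 hy k
      rw [mem_ofPred_eq, ← hk, Nat.cast_le] at this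
      omega)
  have : f '' A = ⋃ k, f '' (A \ f ⁻¹' B k) := by
    refine Subset.antisymm ?_ (iUnion_subset fun k => image_mono sdiff_subset)
    rintro _ ⟨x, hx, rfl⟩
    obtain ⟨k, hk⟩ : ∃ k, f x ∉ B k := by
      by_contra! h
      exact hB'.subset (mem_iInter.2 h)
    exact mem_iUnion.2 ⟨k, x, ⟨hx, hk⟩, rfl⟩
  rw [this]
  refine .iUnion fun k => .image_of_encard_fiber_le hf (k + 1) (hA.diff (hf (hB k))) fun y => ?_
  by_cases hy : y ∈ B k
  · have : A \ f ⁻¹' B k ∩ f ⁻¹' {y} = ∅ := eq_empty_of_forall_notMem fun x hx =>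
      hx.1.2 (by have : f x = y := hx.2
                 simpa [this] using hy)
    simp [this]
  · exact (encard_le_encard (inter_subset_inter_left _ sdiff_subset)).trans
      (not_le.1 fun h => hy (hDB k h)).le

end FiniteToOne

/-! ### Borelness of orbit relations and of relations induced on the factor -/

theorem Setoid.isBorel_orbitRel {G X : Type*} [Group G] [Countable G] [MeasurableSpace X]
    [StandardBorelSpace X] [MulAction G X] (hX : ∀ g : G, Measurable (fun x : X => g • x)) :
    (MulAction.orbitRel G X).IsBorel := by
  have : {p : X × X | MulAction.orbitRel G X p.1 p.2} = ⋃ g : G, {p | g • p.2 = p.1} := by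
    ext p
    simp [MulAction.orbitRel_apply, MulAction.mem_orbit_iff]
  rw [Setoid.IsBorel, this]
  exact .iUnion fun g => measurableSet_eq_fun ((hX g).comp measurable_snd) measurable_fst

section Saturation

variable {X Y : Type*}

/-- The fibres of `f` over two points are `E`-related if they have the same `E`-saturation. -/
def Setoid.fiberSaturation (E : Setoid X) (f : X → Y) : Setoid Y where
  r y y' := (∀ x, f x = y → ∃ x', f x' = y' ∧ E x x') ∧ ∀ x, f x = y' → ∃ x', f x' = y ∧ E x x'
  iseqv :=
    { refl := fun _ => ⟨fun x hx => ⟨x, hx, E.refl x⟩, fun x hx => ⟨x, hx, E.refl x⟩⟩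
      symm := And.symm
      trans := by
        rintro a b c ⟨h1, h2⟩ ⟨h3, h4⟩
        constructor
        · intro x hx
          obtain ⟨x', hx', h⟩ := h1 x hx
          obtain ⟨x'', hx'', h'⟩ := h3 x' hx'
          exact ⟨x'', hx'', E.trans h h'⟩
        · intro x hx
          obtain ⟨x', hx', h⟩ := h4 x hx
          obtain ⟨x'', hx'', h'⟩ := h2 x' hx'
          exact ⟨x'', hx'', E.trans h h'⟩ }

theorem Setoid.fiberSaturation_apply {E : Setoid X} {f : X → Y} {y y' : Y} :
    E.fiberSaturation f y y' ↔
      (∀ x, f x = y → ∃ x', f x' = y' ∧ E x x') ∧ ∀ x, f x = y' → ∃ x', f x' = y ∧ E x x' :=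
  Iff.rfl

/-- For any one `x` over `y`, the class of `y` lies in the `f`-image of the class of `x`. -/
theorem Setoid.HasFiniteClasses.fiberSaturation {E : Setoid X} (hE : E.HasFiniteClasses)
    {f : X → Y} (hf : Function.Surjective f) : (E.fiberSaturation f).HasFiniteClasses := by
  intro y
  obtain ⟨x, hx⟩ := hf y
  refine ((hE x).image f).subset fun y' hy' => ?_
  obtain ⟨x', hx', h⟩ := hy'.1 x hx
  exact ⟨x', h, hx'⟩

theorem Setoid.IsBorel.fiberSaturation {G : Type*} [Group G] [Countable G] [MeasurableSpace X]
    [StandardBorelSpace X] [MeasurableSpace Y] [StandardBorelSpace Y] [MulAction G X]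
    (hX : ∀ g : G, Measurable (fun x : X => g • x)) {E : Setoid X} (hE : E.IsBorel)
    (hEG : ∀ x x', E x x' → MulAction.orbitRel G X x x') {f : X → Y} (hf : Measurable f)
    (hfin : ∀ y, (f ⁻¹' {y}).Finite) : (E.fiberSaturation f).IsBorel := by
  let B : Set (X × Y) := {p | ∃ x', f x' = p.2 ∧ E p.1 x'}
  have hB : MeasurableSet B := by
    -- As `E` lies inside the orbit relation, the witness `x'` ranges over the countable orbit of
    -- `p.1`.
    have : B = ⋃ g : G, {p | f (g • p.1) = p.2} ∩ {p | E p.1 (g • p.1)} := by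
      ext p
      simp only [B, mem_ofPred_eq, mem_iUnion, mem_inter_iff]
      constructor
      · rintro ⟨x', hx', h⟩
        obtain ⟨g, rfl⟩ := hEG _ _ (E.symm h)
        exact ⟨g, hx', h⟩
      · rintro ⟨g, hg, h⟩
        exact ⟨g • p.1, hg, h⟩
    rw [this]
    refine .iUnion fun g => .inter ?_ ?_
    · exact measurableSet_eq_fun (hf.comp ((hX g).comp measurable_fst)) measurable_snd
    · exact (measurable_fst.prodMk ((hX g).comp measurable_fst)) hE
  -- The universal quantifier over a fibre is the complement of an image under the finite-to-one map
  -- `f × id`.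
  let C : Set (Y × Y) := (Prod.map f id '' Bᶜ)ᶜ
  have hC : MeasurableSet C := by
    refine (MeasurableSet.image_of_finite_fiber (hf.prodMap measurable_id) hB.compl ?_).compl
    rintro ⟨y, y'⟩
    refine ((hfin y).prod (finite_singleton y')).subset ?_
    rintro ⟨x, z⟩ hx
    simpa using hx
  have hC' : ∀ y y', (y, y') ∈ C ↔ ∀ x, f x = y → ∃ x', f x' = y' ∧ E x x' := by
    intro y y'
    simp only [C, B, mem_compl_iff, mem_image, Prod.exists, Prod.map, Prod.mk.injEq, id, mem_ofPred_eq]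
    constructor
    · intro h x hx
      by_contra hne
      exact h ⟨x, y', hne, hx, rfl⟩
    · rintro h ⟨x, z, hne, hx, rfl⟩
      exact hne (h x hx)
  have : {p : Y × Y | E.fiberSaturation f p.1 p.2} = C ∩ Prod.swap ⁻¹' C := by
    ext ⟨y, y'⟩
    simp only [mem_ofPred_eq, mem_inter_iff, mem_preimage, Prod.swap_prod_mk, hC',
      fiberSaturation_apply]
  rw [Setoid.IsBorel, this]
  exact hC.inter (measurable_swap hC)

end Saturation

/-! ### Transfer of hyperfiniteness in both directions -/

section Hyperfinite

variable {G X Y : Type*} [Group G] [Countable G]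
  [MeasurableSpace X] [StandardBorelSpace X] [MeasurableSpace Y] [MulAction G X] [MulAction G Y]

/-- Hyperfiniteness of the orbit equivalence relation passes to finite-to-one equivariant
extensions. -/
theorem Setoid.IsHyperfinite.orbitRel_of_finite_fiber
    (hX : ∀ g : G, Measurable (fun x : X => g • x)) {f : X → Y} (hf : Measurable f)
    (hf_equivariant : ∀ (g : G) (x : X), f (g • x) = g • f x)
    (hf_finite : ∀ y : Y, (f ⁻¹' {y}).Finite) (h : (MulAction.orbitRel G Y).IsHyperfinite) :
    (MulAction.orbitRel G X).IsHyperfinite := by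
  have hG := Setoid.isBorel_orbitRel hX
  obtain ⟨-, F, hF, hmono, hunion⟩ := h
  refine ⟨hG, fun n => (F n).comap f ⊓ MulAction.orbitRel G X, fun n => ⟨?_, fun x => ?_⟩,
    fun n x x' hx => ⟨hmono n _ _ hx.1, hx.2⟩, fun x x' => ⟨fun hx => ?_, fun ⟨n, hn⟩ => hn.2⟩⟩
  · exact ((hf.prodMap hf) (hF n).1).inter hG
  · refine Finite.subset (((hF n).2 (f x)).preimage' fun y _ => hf_finite y) fun x' hx' => hx'.1
  · have : MulAction.orbitRel G Y (f x) (f x') := by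
      obtain ⟨g, rfl⟩ := hx
      exact ⟨g, (hf_equivariant g x').symm⟩
    obtain ⟨n, hn⟩ := (hunion _ _).1 this
    exact ⟨n, hn, hx⟩

/-- Hyperfiniteness of the orbit equivalence relation passes to finite-to-one equivariant
factors. -/
theorem Setoid.IsHyperfinite.orbitRel_of_surjective_of_finite_fiber [StandardBorelSpace Y]
    (hX : ∀ g : G, Measurable (fun x : X => g • x)) (hY : ∀ g : G, Measurable (fun y : Y => g • y))
    {f : X → Y} (hf : Measurable f) (hf_equivariant : ∀ (g : G) (x : X), f (g • x) = g • f x)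
    (hf_finite : ∀ y : Y, (f ⁻¹' {y}).Finite) (hf_surj : Function.Surjective f)
    (h : (MulAction.orbitRel G X).IsHyperfinite) : (MulAction.orbitRel G Y).IsHyperfinite := by
  obtain ⟨-, F, hF, hmono, hunion⟩ := h
  refine ⟨Setoid.isBorel_orbitRel hY, fun n => (F n).fiberSaturation f, fun n => ⟨?_, ?_⟩,
    fun n y y' hy => ?_, fun y y' => ⟨fun hy => ?_, ?_⟩⟩
  · exact (hF n).1.fiberSaturation hX (fun x x' hx => (hunion x x').2 ⟨n, hx⟩) hf hf_finite
  · exact (hF n).2.fiberSaturation hf_surj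
  · refine ⟨fun x hx => ?_, fun x hx => ?_⟩
    · obtain ⟨x', hx', h⟩ := hy.1 x hx
      exact ⟨x', hx', hmono n _ _ h⟩
    · obtain ⟨x', hx', h⟩ := hy.2 x hx
      exact ⟨x', hx', hmono n _ _ h⟩
  · obtain ⟨g, rfl⟩ := hy
    have hmono' : ∀ x x', Monotone fun n => F n x x' := fun x x' =>
      monotone_nat_of_le_succ fun n => hmono n x x'
    have hev : ∀ x ∈ f ⁻¹' {y'}, ∀ᶠ n in Filter.atTop, F n (g • x) x := fun x _ => by
      obtain ⟨n, hn⟩ := (hunion (g • x) x).1 ⟨g, rfl⟩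
      exact Filter.eventually_atTop.2 ⟨n, fun m hm => hmono' _ _ hm hn⟩
    -- Finiteness of the fibre makes `n` uniform in `x`.
    obtain ⟨n, hn⟩ := ((hf_finite y').eventually_all.2 hev).exists
    refine ⟨n, fun x hx => ?_, fun x hx => ?_⟩
    · have hx' : f (g⁻¹ • x) = y' := by rw [hf_equivariant, hx, inv_smul_smul]
      exact ⟨g⁻¹ • x, hx', by simpa using hn _ hx'⟩
    · exact ⟨g • x, by rw [hf_equivariant, hx], (F n).symm (hn x hx)⟩
  · rintro ⟨n, hn⟩
    obtain ⟨x, rfl⟩ := hf_surj y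
    obtain ⟨x', rfl, h⟩ := hn.1 x rfl
    obtain ⟨g, rfl⟩ := (hunion x x').2 ⟨n, h⟩
    exact ⟨g, (hf_equivariant g x').symm⟩

end Hyperfinite

theorem lemma5p1 {G X Y : Type*} [Group G] [Countable G]
    [MeasurableSpace X] [StandardBorelSpace X] [MeasurableSpace Y] [StandardBorelSpace Y]
    [MulAction G X] [MulAction G Y]
    (hX : ∀ g : G, Measurable (fun x : X => g • x))
    (hY : ∀ g : G, Measurable (fun y : Y => g • y))
    (f : X → Y) (hf : Measurable f)
    (hf_equivariant : ∀ (g : G) (x : X), f (g • x) = g • f x)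
    (hf_finite : ∀ y : Y, (f ⁻¹' {y}).Finite)
    (hf_surj : Function.Surjective f) :
    (MulAction.orbitRel G X).IsHyperfinite ↔ (MulAction.orbitRel G Y).IsHyperfinite := by
  exact ⟨fun h => h.orbitRel_of_surjective_of_finite_fiber hX hY hf hf_equivariant hf_finite hf_surj,
    fun h => h.orbitRel_of_finite_fiber hX hf hf_equivariant hf_finite⟩
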